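/- **Setting.** Let $G=(V,E)$ be a finite simple graph on $n=|V|$ vertices, let $J_e\in\mathbb R$ $(e\in E)$ be couplings, and let $\beta,d,\varepsilon>0$. Write $\partial_{\rm out}S$ for the set of vertices outside $S$ that have a neighbour in $S$. Put $\Gamma_e=\frac{|1-e^{\beta J_e}|}{1+e^{\beta J_e}}$ and $A(u)=\sum_{w\sim u}\Gamma_{\{u,w\}}$. Give $u$ the weight $M(u)=1-\varepsilon/4$ if $A(u)\le 1-\varepsilon/2$, and $M(u)=d\,A(u)$ otherwise. A vertex $u$ is a *block vertex* if $\prod_{x\in P}M(x)<1$ for every path $P$ of length at most $\log n$ starting at $u$. A partition $\mathcal B$ of $V$ is a *$(d,\varepsilon)$-block partition* if every $B\in\mathcal B$ satisfies the following: 1. $B$ induces a tree with at most one extra edge. 2. If $|B|>1$, then every $w\in\partial_{\rm out}B$ is a block vertex and has exactly one neighbour in $B$; moreover, a cycle in $B$, if there is one, has length at most $4\log n/\log^4 d$ and distance at least $\log^5 d$ from $\partial_{\rm out}B$. 3. If $B=\{u\}$, then $u$ is a block vertex. The collection $\mathcal T=\mathcal T(\mathcal B)$ consists of the following rooted trees,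 each of them an induced subgraph of $G$: * (a) $B\cup\partial_{\rm out}B$, for a block $B\in\mathcal B$ with $|B|>1$ that is a tree, rooted at any of its vertices; * (b) for a block $B\in\mathcal B$ with a cycle $C$ and a vertex $v$ of $C$, the connected component of $v$ in $B\cup\partial_{\rm out}B$ after all edges of $C$ are deleted, rooted at $v$. For a path $P$ in $G$ let $$\Upsilon(P)=\beta\sum_{e}|J_e|+\sum_{x\in P}\log\deg_G(x),$$ where the first sum is over all edges $e$ of $G$ with at least one endpoint in $P$. For a vertex set $T$ and a configuration $\sigma$ on $\partial_{\rm out}T$, let $\mu_T^\sigma$ be the distribution on $\{\pm1\}^T$ given by $$\mu_T^\sigma(\tau)\propto\exp\Big(\beta\sum_{\{x,y\}\in E}\mathbf 1\{\eta(x)=\eta(y)\}J_{\{x,y\}}\Big),$$ where $\eta$ equals $\tau$ on $T$ and $\sigma$ on $\partial_{\rm out}T$, and the sum is over the edges that meet $T$. *Glauber dynamics* on $T$ updates a vertex by drawing its spin from its conditional distribution under $\mu_T^\sigma$ given all the other spins. In continuous time, every vertex is updated at rate $1$; the relaxation time $\tau_{\rm rel}(T,\sigma)$ is the inverse of the spectral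 gap of the generator. In discrete time, each step updates one uniformly random vertex of $T$; the relaxation time $\tau^{\rm disc}_{\rm rel}(T,\sigma)$ is $1/(1-\lambda^*)$, with $\lambda^*$ the second largest eigenvalue in modulus of the transition matrix. **Theorem.** Let $\mathcal B$ be a $(d,\varepsilon)$-block partition, let $T\in\mathcal T(\mathcal B)$ with root $v$, and let $\sigma$ be any configuration on $\partial_{\rm out}T$. Let $m(T,v)=\max_P\Upsilon(P)$, where $P$ ranges over all paths from the root $v$ to a leaf of $T$ (the maximum is attained). Then $$\tau_{\rm rel}(T,\sigma)\le\exp\big(m(T,v)\big)\qquad\text{and}\qquad \tau^{\rm disc}_{\rm rel}(T,\sigma)\le |T|\,\exp\big(m(T,v)\big).$$ -/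

import Mathlib

/-!
Ising-type spin glass with couplings `J` on the edges of a finite graph, the block partitions built
from edge influences, the trees obtained from the blocks, and (heat-bath) Glauber dynamics on them.
-/

noncomputable section

namespace SpinGlass

variable {V : Type*} [Fintype V] [DecidableEq V]

/-! ### Influences, weights and block partitions -/

/-- The influence `|1 - exp (β J_e)| / (1 + exp (β J_e))` of an edge. -/
def edgeInfluence (J : Sym2 V → ℝ) (β : ℝ) (e : Sym2 V) : ℝ :=
  |1 - Real.exp (β * J e)| / (1 + Real.exp (β * J e))

open Classical in
/-- The aggregate influence of a vertex: the sum of the influences of its incident edges. -/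
def aggregateInfluence (G : SimpleGraph V) (J : Sym2 V → ℝ) (β : ℝ) (u : V) : ℝ :=
  ∑ w ∈ G.neighborFinset u, edgeInfluence J β s(u, w)

open Classical in
/-- The `(d, ε)`-weight of a vertex. -/
def vertexWeight (G : SimpleGraph V) (J : Sym2 V → ℝ) (β d ε : ℝ) (u : V) : ℝ :=
  if aggregateInfluence G J β u ≤ 1 - ε / 2 then 1 - ε / 4
  else d * aggregateInfluence G J β u

/-- A `(d, ε)`-block vertex: every path of length at most `log n` that starts at `u`
has weight (the product of the weights of its vertices) less than one. -/
def IsBlockVertex (G : SimpleGraph V) (J : Sym2 V → ℝ) (β d ε : ℝ) (u : V) : Prop :=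
  ∀ (w : V) (p : G.Walk u w), p.IsPath → (p.length : ℝ) ≤ Real.log (Fintype.card V) →
    (p.support.map (vertexWeight G J β d ε)).prod < 1

open Classical in
/-- The vertices outside `S` that have a neighbour in `S`. -/
def outerBoundary (G : SimpleGraph V) (S : Finset V) : Finset V :=
  Finset.univ.filter fun w => w ∉ S ∧ ∃ x ∈ S, G.Adj w x

open Classical in
/-- A `(d, ε)`-block partition of the vertex set. -/
structure IsBlockPartition (G : SimpleGraph V) (J : Sym2 V → ℝ) (β d ε : ℝ)
    (𝓑 : Finpartition (Finset.univ : Finset V)) : Prop where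
  /-- Every block induces a tree with at most one extra edge: a connected graph that has
  at most as many edges as vertices. -/
  connected : ∀ B ∈ 𝓑.parts, (G.induce (B : Set V)).Connected
  edges_le : ∀ B ∈ 𝓑.parts, (G.edgeFinset.filter fun e => ∀ x ∈ e, x ∈ B).card ≤ B.card
  boundary_block : ∀ B ∈ 𝓑.parts, 1 < B.card →
    ∀ w ∈ outerBoundary G B, IsBlockVertex G J β d ε w
  boundary_unique : ∀ B ∈ 𝓑.parts, 1 < B.card →
    ∀ w ∈ outerBoundary G B, ∃! x, x ∈ B ∧ G.Adj w x
  cycle_short : ∀ B ∈ 𝓑.parts, 1 < B.card →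
    ∀ (x : V) (c : G.Walk x x), c.IsCycle → (∀ y ∈ c.support, y ∈ B) →
      (c.length : ℝ) ≤ 4 * (Real.log (Fintype.card V) / Real.log d ^ 4)
  cycle_far : ∀ B ∈ 𝓑.parts, 1 < B.card →
    ∀ (x : V) (c : G.Walk x x), c.IsCycle → (∀ y ∈ c.support, y ∈ B) →
      ∀ y ∈ c.support, ∀ w ∈ outerBoundary G B, Real.log d ^ 5 ≤ (G.dist y w : ℝ)
  single_block : ∀ u, {u} ∈ 𝓑.parts → IsBlockVertex G J β d ε u

/-! ### The trees of a block partition -/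

/-- The graph induced by `G` on `U`, with the edges in the list `l` deleted, as a graph on `V`. -/
def inducedMinus (G : SimpleGraph V) (U : Finset V) (l : List (Sym2 V)) : SimpleGraph V where
  Adj x y := G.Adj x y ∧ x ∈ U ∧ y ∈ U ∧ s(x, y) ∉ l
  symm := ⟨fun x y h => ⟨h.1.symm, h.2.2.1, h.2.1, by rw [Sym2.eq_swap]; exact h.2.2.2⟩⟩
  loopless := ⟨fun x h => G.loopless.irrefl x h.1⟩

open Classical in
/-- `IsBlockTree G 𝓑 S v`: the subgraph of `G` induced by `S` is a tree of the collection that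
belongs to `𝓑`, rooted at `v`. Either `S` is a multi-vertex tree block `B` with its outer
boundary (and `v` is any of its vertices), or `v` lies on the cycle `c` of a unicyclic block
`B`, and `S` is the component of `v` in what is left of `B` with its outer boundary when all
the edges of `c` are deleted. -/
def IsBlockTree (G : SimpleGraph V) (𝓑 : Finpartition (Finset.univ : Finset V))
    (S : Finset V) (v : V) : Prop :=
  (G.induce (S : Set V)).IsTree ∧ ∃ B ∈ 𝓑.parts,
    (1 < B.card ∧ (G.induce (B : Set V)).IsTree ∧ S = B ∪ outerBoundary G B ∧ v ∈ S) ∨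
    (∃ c : G.Walk v v, c.IsCycle ∧ (∀ y ∈ c.support, y ∈ B) ∧
      S = Finset.univ.filter
        fun x => (inducedMinus G (B ∪ outerBoundary G B) c.edges).Reachable v x)

/-! ### The weight of root-to-leaf paths -/

open Classical in
/-- `β ∑ |J_e| + ∑ log deg x`: the first sum is over the edges of `G` with at least one endpoint
on the path, the second one over the vertices of the path; degrees are those in `G`. -/
def pathUpsilon (G : SimpleGraph V) (J : Sym2 V → ℝ) (β : ℝ) {u w : V} (p : G.Walk u w) : ℝ :=
  β * ∑ e ∈ G.edgeFinset.filter (fun e => ∃ x ∈ p.support, x ∈ e), |J e| +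
    ∑ x ∈ p.support.toFinset, Real.log (G.degree x)

/-- A path from the root `v` to a leaf `u` of the tree induced by `S`. A leaf is a vertex without
children: all its neighbours in the tree are on the path that joins it to the root. -/
def IsRootToLeafPath (G : SimpleGraph V) (S : Finset V) {v u : V} (p : G.Walk v u) : Prop :=
  p.IsPath ∧ (∀ x ∈ p.support, x ∈ S) ∧ ∀ w ∈ S, G.Adj u w → w ∈ p.support

/-- The weights of all paths from the root `v` to the leaves of the tree induced by `S`. -/
def rootToLeafWeights (G : SimpleGraph V) (J : Sym2 V → ℝ) (β : ℝ) (S : Finset V) (v : V) :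
    Set ℝ :=
  {a | ∃ (u : V) (p : G.Walk v u), IsRootToLeafPath G S p ∧ a = pathUpsilon G J β p}

/-! ### Gibbs distributions and Glauber dynamics -/

/-- The configuration on `V` that is `τ` on `S` and `σ` off `S`. -/
def glue {S : Finset V} (σ : V → ℤˣ) (τ : S → ℤˣ) (x : V) : ℤˣ :=
  if h : x ∈ S then τ ⟨x, h⟩ else σ x

open Classical in
/-- The unnormalised Gibbs weight of `τ` on `S` with boundary condition `σ`: the exponential of `β`
times the sum of the couplings of the edges meeting `S` on whose endpoints the spins agree. It
depends only on the values of `σ` on the outer boundary of `S`. -/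
def gibbsWeight (G : SimpleGraph V) (J : Sym2 V → ℝ) (β : ℝ) (S : Finset V) (σ : V → ℤˣ)
    (τ : S → ℤˣ) : ℝ :=
  Real.exp (β * ∑ e ∈ G.edgeFinset.filter (fun e => ∃ x ∈ S, x ∈ e),
    if ∀ x ∈ e, ∀ y ∈ e, glue σ τ x = glue σ τ y then J e else 0)

/-- The Gibbs distribution on `S` given the configuration `σ` on the outer boundary of `S`. -/
def gibbs (G : SimpleGraph V) (J : Sym2 V → ℝ) (β : ℝ) (S : Finset V) (σ : V → ℤˣ)
    (τ : S → ℤˣ) : ℝ :=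
  gibbsWeight G J β S σ τ / ∑ τ' : S → ℤˣ, gibbsWeight G J β S σ τ'

open Classical in
/-- The transition matrix of a heat-bath update at `x`: the spin at `x` is drawn from its
conditional distribution given all other spins. -/
def siteUpdate (G : SimpleGraph V) (J : Sym2 V → ℝ) (β : ℝ) (S : Finset V) (σ : V → ℤˣ) (x : S) :
    Matrix (S → ℤˣ) (S → ℤˣ) ℝ :=
  fun τ τ' => if ∀ y, y ≠ x → τ' y = τ y then
    gibbs G J β S σ τ' / ∑ s : ℤˣ, gibbs G J β S σ (Function.update τ x s) else 0

/-- The transition matrix of discrete-time Glauber dynamics: each step updates one uniformly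
random vertex of `S`. -/
def glauberMatrix (G : SimpleGraph V) (J : Sym2 V → ℝ) (β : ℝ) (S : Finset V) (σ : V → ℤˣ) :
    Matrix (S → ℤˣ) (S → ℤˣ) ℝ :=
  (S.card : ℝ)⁻¹ • ∑ x : S, siteUpdate G J β S σ x

/-- The generator of continuous-time Glauber dynamics: each vertex of `S` is updated at rate one. -/
def glauberGenerator (G : SimpleGraph V) (J : Sym2 V → ℝ) (β : ℝ) (S : Finset V) (σ : V → ℤˣ) :
    Matrix (S → ℤˣ) (S → ℤˣ) ℝ :=
  ∑ x : S, (siteUpdate G J β S σ x - 1)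

/-- The relaxation time `1 / (1 - λ*)` of an irreducible reversible transition matrix, with `λ*` the
largest modulus of an eigenvalue other than one. -/
def discreteRelaxationTime {Ω : Type*} [Fintype Ω] [DecidableEq Ω] (P : Matrix Ω Ω ℝ) : ℝ :=
  1 / (1 - sSup {r | ∃ l : ℝ, Module.End.HasEigenvalue (Matrix.toLin' P) l ∧ l ≠ 1 ∧ r = |l|})

/-- The relaxation time of an irreducible reversible generator: the inverse of its spectral gap,
which is the least nonzero eigenvalue of `-L`. -/
def relaxationTime {Ω : Type*} [Fintype Ω] [DecidableEq Ω] (L : Matrix Ω Ω ℝ) : ℝ :=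
  1 / sInf {r | Module.End.HasEigenvalue (Matrix.toLin' (-L)) r ∧ r ≠ 0}

end SpinGlass

end

/-!
Poincaré inequalities for spin systems on rooted forests, by tensorisation and comparison, and the
resulting bounds on the relaxation times of Glauber dynamics.
-/

noncomputable section

namespace SpinGlass

/-! ### Poincaré inequalities for weights on spin configurations -/

section Poincare

variable {A : Type*} [Fintype A] [DecidableEq A]

/-! Orient the tree away from its root and let `a x` be β times the sum of |J| over the edges from
`x` to its children. Deleting these edges makes `x` independent of what lies below it, and changes
the Gibbs weight by a factor whose oscillation is at most exp(`a x`). By `PoincareIneq.compare`, the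
Poincaré constant changes by no more than that factor.

Once `x` is cut off, the subtrees of its children do not interact, and by `PoincareIneq.prod` the
constant of a product is the maximum, not the product, of the constants of its factors. So only the
costs along one descending path multiply: `poincareIneq_of_isForestBound` gives exp of the largest
sum of `a` along such a path. The edges counted in that sum are distinct and meet the path, so the
sum is at most Υ; the log-degree terms are nonnegative and are simply dropped
(`sum_child_le_pathUpsilon`).

The Dirichlet form is the sum over sites of the mean conditional variance, so the Poincaré
inequality bounds the nonzero eigenvalues of the negated generator from below
(`PoincareIneq.one_le_mul_eigenvalue`). The discrete chain is a rescaling by the number of sites;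
its eigenvalues are nonnegative, because heat-bath updates are orthogonal projections, so taking the
modulus costs nothing. -/

/-- The configuration `τ` with the spin at `x` flipped. -/
def flipAt (x : A) (τ : A → ℤˣ) : A → ℤˣ := Function.update τ x (-τ x)

omit [Fintype A] in
theorem flipAt_flipAt (x : A) (τ : A → ℤˣ) : flipAt x (flipAt x τ) = τ := by
  ext y; by_cases h : y = x
  · subst h; simp [flipAt]
  · simp [flipAt, h]

theorem sum_flipAt (x : A) (φ : (A → ℤˣ) → ℝ) : ∑ τ, φ (flipAt x τ) = ∑ τ, φ τ :=
  Equiv.sum_comp (Function.Involutive.toPerm (flipAt x) (flipAt_flipAt x)) φ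

/-- The contribution of the site `x` to the (unnormalised) Dirichlet form of heat-bath dynamics. -/
def siteDirichlet (w f : (A → ℤˣ) → ℝ) (x : A) : ℝ :=
  ∑ τ, w τ * w (flipAt x τ) / (w τ + w (flipAt x τ)) * (f τ - f (flipAt x τ)) ^ 2 / 2

/-- The weight `w` satisfies a Poincaré inequality with constant `C`. -/
def PoincareIneq (w : (A → ℤˣ) → ℝ) (C : ℝ) : Prop :=
  ∀ f : (A → ℤˣ) → ℝ, ∃ c : ℝ, ∑ τ, w τ * (f τ - c) ^ 2 ≤ C * ∑ x, siteDirichlet w f x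

theorem siteDirichlet_nonneg {w : (A → ℤˣ) → ℝ} (hw : ∀ τ, 0 < w τ) (f : (A → ℤˣ) → ℝ) (x : A) :
    0 ≤ siteDirichlet w f x := by
  refine Finset.sum_nonneg fun τ _ => ?_
  have := hw τ; have := hw (flipAt x τ)
  positivity

theorem PoincareIneq.mono {w : (A → ℤˣ) → ℝ} (hw : ∀ τ, 0 < w τ) {C C' : ℝ} (h : PoincareIneq w C)
    (hC : C ≤ C') : PoincareIneq w C' := fun f => by
  obtain ⟨c, hc⟩ := h f
  exact ⟨c, hc.trans (mul_le_mul_of_nonneg_right hC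
    (Finset.sum_nonneg fun x _ => siteDirichlet_nonneg hw f x))⟩

/-- The quantity equals 1/(1/a + 1/b), which increases in both arguments. This allows Dirichlet
forms of comparable weights to be compared term by term. -/
theorem mul_div_add_mono {a b a' b' : ℝ} (ha : 0 < a) (hb : 0 < b) (haa : a ≤ a') (hbb : b ≤ b') :
    a * b / (a + b) ≤ a' * b' / (a' + b') := by
  have ha' := ha.trans_le haa
  have hb' := hb.trans_le hbb
  rw [div_le_div_iff₀ (by positivity) (by positivity)]
  nlinarith [mul_le_mul_of_nonneg_left hbb (mul_pos ha ha').le,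
    mul_le_mul_of_nonneg_left haa (mul_pos hb hb').le]

/-- A Poincaré inequality survives a bounded change of the weight. -/
theorem PoincareIneq.compare {w w' : (A → ℤˣ) → ℝ} {l u C : ℝ} (hw' : ∀ τ, 0 < w' τ) (hl : 0 < l)
    (hu : 0 ≤ u) (hC : 0 ≤ C) (hlw : ∀ τ, l * w' τ ≤ w τ) (huw : ∀ τ, w τ ≤ u * w' τ)
    (h : PoincareIneq w' C) : PoincareIneq w (u / l * C) := fun f => by
  obtain ⟨c, hc⟩ := h f
  have hD : ∀ x, l * siteDirichlet w' f x ≤ siteDirichlet w f x := fun x => by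
    unfold siteDirichlet
    rw [Finset.mul_sum]
    refine Finset.sum_le_sum fun τ _ => ?_
    have h1 := hw' τ
    have h2 := hw' (flipAt x τ)
    have := mul_div_add_mono (mul_pos hl h1) (mul_pos hl h2) (hlw τ) (hlw (flipAt x τ))
    have e : l * w' τ * (l * w' (flipAt x τ)) / (l * w' τ + l * w' (flipAt x τ))
        = l * (w' τ * w' (flipAt x τ) / (w' τ + w' (flipAt x τ))) := by
      field_simp
    rw [e] at this
    calc _ = l * (w' τ * w' (flipAt x τ) / (w' τ + w' (flipAt x τ))) *
          ((f τ - f (flipAt x τ)) ^ 2 / 2) := by ring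
      _ ≤ _ := mul_le_mul_of_nonneg_right this (by positivity)
      _ = _ := by ring
  -- The centre found for `w'` also serves `w`; leaving the centre free in `PoincareIneq` avoids
  -- tracking how the mean moves.
  refine ⟨c, ?_⟩
  calc ∑ τ, w τ * (f τ - c) ^ 2 ≤ ∑ τ, u * (w' τ * (f τ - c) ^ 2) :=
        Finset.sum_le_sum fun τ _ => by
          rw [← mul_assoc]; exact mul_le_mul_of_nonneg_right (huw τ) (sq_nonneg _)
    _ = u * ∑ τ, w' τ * (f τ - c) ^ 2 := (Finset.mul_sum ..).symm
    _ ≤ u * (C * ∑ x, siteDirichlet w' f x) := mul_le_mul_of_nonneg_left hc hu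
    _ = u / l * C * (l * ∑ x, siteDirichlet w' f x) := by field_simp
    _ ≤ u / l * C * ∑ x, siteDirichlet w f x := by
        rw [Finset.mul_sum]
        exact mul_le_mul_of_nonneg_left (Finset.sum_le_sum fun x _ => hD x) (by positivity)

end Poincare

/-! ### Second moments and tensorisation -/

/-- The bias-variance decomposition for a weighted sum of squares. -/
theorem sum_mul_sub_sq {Ω : Type*} [Fintype Ω] (w g : Ω → ℝ) (hZ : ∑ a, w a ≠ 0) (c : ℝ) :
    ∑ a, w a * (g a - c) ^ 2 = ∑ a, w a * (g a - (∑ a, w a * g a) / ∑ a, w a) ^ 2 +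
      (∑ a, w a) * ((∑ a, w a * g a) / (∑ a, w a) - c) ^ 2 := by
  have key : ∀ t, ∑ a, w a * (g a - t) ^ 2 =
      ∑ a, w a * g a ^ 2 - 2 * t * ∑ a, w a * g a + t ^ 2 * ∑ a, w a := fun t => by
    rw [Finset.mul_sum, Finset.mul_sum, ← Finset.sum_sub_distrib, ← Finset.sum_add_distrib]
    exact Finset.sum_congr rfl fun a _ => by ring
  rw [key, key]
  field_simp
  ring

/-- Jensen's inequality for the square. -/
theorem sum_mul_sq_mean_le {Ω : Type*} [Fintype Ω] (w g : Ω → ℝ) (hw : ∀ a, 0 ≤ w a)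
    (hZ : ∑ a, w a ≠ 0) :
    (∑ a, w a) * ((∑ a, w a * g a) / ∑ a, w a) ^ 2 ≤ ∑ a, w a * g a ^ 2 := by
  have := sum_mul_sub_sq w g hZ 0
  simp only [sub_zero] at this
  rw [this]
  exact le_add_of_nonneg_left (Finset.sum_nonneg fun a _ => mul_nonneg (hw a) (sq_nonneg _))

section Product

variable {A : Type*} [Fintype A] [DecidableEq A] (p : A → Prop) [DecidablePred p]

/-- The configuration made of configurations on the sites with `p` and on those without `p`. -/
def joinConfig (a : {x // p x} → ℤˣ) (b : {x // ¬p x} → ℤˣ) : A → ℤˣ :=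
  (Equiv.piEquivPiSubtypeProd p fun _ => ℤˣ).symm (a, b)

variable {p}

omit [Fintype A] [DecidableEq A] in
theorem joinConfig_left (a : {x // p x} → ℤˣ) (b : {x // ¬p x} → ℤˣ) (x : {x // p x}) :
    joinConfig p a b x = a x := by
  simp [joinConfig, Equiv.piEquivPiSubtypeProd, x.2]

omit [Fintype A] [DecidableEq A] in
theorem joinConfig_right (a : {x // p x} → ℤˣ) (b : {x // ¬p x} → ℤˣ) (x : {x // ¬p x}) :
    joinConfig p a b x = b x := by
  simp [joinConfig, Equiv.piEquivPiSubtypeProd, x.2]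

omit [Fintype A] in
theorem flipAt_joinConfig_left (a : {x // p x} → ℤˣ) (b : {x // ¬p x} → ℤˣ) (x : {x // p x}) :
    flipAt x.1 (joinConfig p a b) = joinConfig p (flipAt x a) b := by
  funext y
  by_cases hy : p y
  · rw [joinConfig_left _ _ ⟨y, hy⟩]
    by_cases h : y = x
    · subst h; simp [flipAt, joinConfig_left]
    · have h' : (⟨y, hy⟩ : {x // p x}) ≠ x := fun e => h (congrArg Subtype.val e)
      simp only [flipAt, Function.update_of_ne h, Function.update_of_ne h']
      exact joinConfig_left a b ⟨y, hy⟩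
  · rw [joinConfig_right _ _ ⟨y, hy⟩]
    have h : y ≠ x := fun e => hy (e ▸ x.2)
    simp only [flipAt, Function.update_of_ne h]
    exact joinConfig_right a b ⟨y, hy⟩

omit [Fintype A] in
theorem flipAt_joinConfig_right (a : {x // p x} → ℤˣ) (b : {x // ¬p x} → ℤˣ) (x : {x // ¬p x}) :
    flipAt x.1 (joinConfig p a b) = joinConfig p a (flipAt x b) := by
  funext y
  by_cases hy : p y
  · rw [joinConfig_left _ _ ⟨y, hy⟩]
    have h : y ≠ x := fun e => x.2 (e ▸ hy)
    simp only [flipAt, Function.update_of_ne h]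
    exact joinConfig_left a b ⟨y, hy⟩
  · rw [joinConfig_right _ _ ⟨y, hy⟩]
    by_cases h : y = x
    · subst h; simp [flipAt, joinConfig_right]
    · have h' : (⟨y, hy⟩ : {x // ¬p x}) ≠ x := fun e => h (congrArg Subtype.val e)
      simp only [flipAt, Function.update_of_ne h, Function.update_of_ne h']
      exact joinConfig_right a b ⟨y, hy⟩

theorem sum_joinConfig (φ : (A → ℤˣ) → ℝ) :
    ∑ τ, φ τ = ∑ b : {x // ¬p x} → ℤˣ, ∑ a : {x // p x} → ℤˣ, φ (joinConfig p a b) := by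
  rw [← Equiv.sum_comp (Equiv.piEquivPiSubtypeProd p fun _ => ℤˣ).symm, Fintype.sum_prod_type,
    Finset.sum_comm]
  rfl

/-- Homogeneity of degree one: under a product weight, the factor of the half that is not flipped
comes out of the Dirichlet form. -/
theorem scaled_mul_div_add {s a b : ℝ} (hs : 0 < s) (ha : 0 < a) (hb : 0 < b) :
    s * a * (s * b) / (s * a + s * b) = s * (a * b / (a + b)) := by
  field_simp

/-- Poincaré inequalities tensorise. -/
theorem PoincareIneq.prod {w : (A → ℤˣ) → ℝ} {w₁ : ({x // p x} → ℤˣ) → ℝ}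
    {w₂ : ({x // ¬p x} → ℤˣ) → ℝ} {C : ℝ} (hC : 0 ≤ C) (hw₁ : ∀ a, 0 < w₁ a) (hw₂ : ∀ b, 0 < w₂ b)
    (hw : ∀ a b, w (joinConfig p a b) = w₁ a * w₂ b)
    (h₁ : PoincareIneq w₁ C) (h₂ : PoincareIneq w₂ C) : PoincareIneq w C := fun f => by
  set Z := ∑ a, w₁ a with hZ
  have hZ0 : 0 < Z := Finset.sum_pos (fun a _ => hw₁ a) Finset.univ_nonempty
  -- `F` is the conditional mean of `f` given the second half; the variance of `f` splits into the
  -- conditional variances and the variance of `F`.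
  set F : ({x // ¬p x} → ℤˣ) → ℝ := fun b => (∑ a, w₁ a * f (joinConfig p a b)) / Z with hF
  have hleft : ∀ x : {x // p x}, siteDirichlet w f x =
      ∑ b, w₂ b * siteDirichlet w₁ (fun a => f (joinConfig p a b)) x := fun x => by
    unfold siteDirichlet
    rw [sum_joinConfig (p := p)]
    refine Finset.sum_congr rfl fun b _ => ?_
    rw [Finset.mul_sum]
    refine Finset.sum_congr rfl fun a _ => ?_
    rw [flipAt_joinConfig_left, hw, hw, mul_comm (w₁ a), mul_comm (w₁ _),
      scaled_mul_div_add (hw₂ b) (hw₁ _) (hw₁ _)]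
    ring
  -- An increment of `F` is a weighted mean of increments of `f`, so Jensen's inequality shows that
  -- averaging does not increase the Dirichlet form.
  have hright : ∀ y : {x // ¬p x}, Z * siteDirichlet w₂ F y ≤ siteDirichlet w f y := fun y => by
    unfold siteDirichlet
    rw [sum_joinConfig (p := p), Finset.mul_sum]
    refine Finset.sum_le_sum fun b _ => ?_
    have h2 := hw₂ b
    have h2' := hw₂ (flipAt y b)
    have e : F b - F (flipAt y b) =
        (∑ a, w₁ a * (f (joinConfig p a b) - f (joinConfig p a (flipAt y b)))) / Z := by
      simp only [hF, mul_sub, Finset.sum_sub_distrib, sub_div]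
    have hJ := sum_mul_sq_mean_le w₁
      (fun a => f (joinConfig p a b) - f (joinConfig p a (flipAt y b))) (fun a => (hw₁ a).le) hZ0.ne'
    rw [← hZ, ← e] at hJ
    calc _ = w₂ b * w₂ (flipAt y b) / (w₂ b + w₂ (flipAt y b)) / 2 *
          (Z * (F b - F (flipAt y b)) ^ 2) := by ring
      _ ≤ _ := mul_le_mul_of_nonneg_left hJ (by positivity)
      _ = _ := by
        rw [Finset.mul_sum]
        refine Finset.sum_congr rfl fun a _ => ?_
        rw [flipAt_joinConfig_right, hw, hw, scaled_mul_div_add (hw₁ a) h2 h2']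
        ring
  obtain ⟨c, hc⟩ := h₂ F
  refine ⟨c, ?_⟩
  have hb : ∀ b, ∑ a, w₁ a * (f (joinConfig p a b) - c) ^ 2 ≤
      C * ∑ x, siteDirichlet w₁ (fun a => f (joinConfig p a b)) x + Z * (F b - c) ^ 2 := fun b => by
    obtain ⟨c₁, hc₁⟩ := h₁ fun a => f (joinConfig p a b)
    -- Bias-variance about both centres: the mean is a better centre than `c₁`, and moving from the
    -- mean to `c` costs exactly the `F` term.
    rw [sum_mul_sub_sq w₁ (fun a => f (joinConfig p a b)) hZ0.ne' c]
    rw [sum_mul_sub_sq w₁ (fun a => f (joinConfig p a b)) hZ0.ne' c₁] at hc₁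
    have : 0 ≤ Z * ((∑ a, w₁ a * f (joinConfig p a b)) / Z - c₁) ^ 2 := by positivity
    simp only [hF]
    linarith
  calc ∑ τ, w τ * (f τ - c) ^ 2
      = ∑ b, w₂ b * ∑ a, w₁ a * (f (joinConfig p a b) - c) ^ 2 := by
        rw [sum_joinConfig (p := p)]
        refine Finset.sum_congr rfl fun b _ => ?_
        rw [Finset.mul_sum]
        exact Finset.sum_congr rfl fun a _ => by rw [hw]; ring
    _ ≤ ∑ b, w₂ b * (C * ∑ x, siteDirichlet w₁ (fun a => f (joinConfig p a b)) x +
          Z * (F b - c) ^ 2) :=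
        Finset.sum_le_sum fun b _ => mul_le_mul_of_nonneg_left (hb b) (hw₂ b).le
    _ = C * ∑ x : {x // p x}, siteDirichlet w f x + Z * ∑ b, w₂ b * (F b - c) ^ 2 := by
        simp only [hleft, mul_add, Finset.sum_add_distrib, Finset.mul_sum]
        rw [Finset.sum_comm]
        congr 1
        · exact Finset.sum_congr rfl fun x _ => Finset.sum_congr rfl fun b _ => by ring
        · exact Finset.sum_congr rfl fun b _ => by ring
    _ ≤ C * ∑ x : {x // p x}, siteDirichlet w f x + Z * (C * ∑ y, siteDirichlet w₂ F y) := by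
        gcongr
    _ = C * ∑ x : {x // p x}, siteDirichlet w f x + C * ∑ y, Z * siteDirichlet w₂ F y := by
        rw [← Finset.mul_sum]; ring
    _ ≤ C * ∑ x : {x // p x}, siteDirichlet w f x + C * ∑ y : {x // ¬p x}, siteDirichlet w f y := by
        gcongr with y; exact hright y
    _ = C * ∑ x, siteDirichlet w f x := by
        rw [← mul_add, Fintype.sum_subtype_add_sum_subtype p fun x => siteDirichlet w f x]

end Product

theorem sum_units_eq (φ : ℤˣ → ℝ) (t : ℤˣ) : ∑ s, φ s = φ t + φ (-t) := by
  have h : (Finset.univ : Finset ℤˣ) = {1, -1} := rfl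
  rw [h, Finset.sum_pair (by decide)]
  rcases Int.units_eq_one_or t with rfl | rfl
  · rfl
  · rw [neg_neg, add_comm]

/-- A single spin satisfies the Poincaré inequality with constant one. -/
theorem poincareIneq_of_unique {A : Type*} [Fintype A] [DecidableEq A] [Unique A]
    {w : (A → ℤˣ) → ℝ} (hw : ∀ τ, 0 < w τ) : PoincareIneq w 1 := fun f => by
  have hsum : ∀ φ : (A → ℤˣ) → ℝ, ∑ τ, φ τ = φ (fun _ => 1) + φ (fun _ => -1) := fun φ => by
    rw [← Equiv.sum_comp (Equiv.funUnique A ℤˣ).symm, sum_units_eq _ 1]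
    rfl
  have f1 : flipAt (default : A) (fun _ => (1 : ℤˣ)) = fun _ => -1 := by
    funext y; rw [Unique.eq_default y]; simp [flipAt]
  have f2 : flipAt (default : A) (fun _ => (-1 : ℤˣ)) = fun _ => 1 := by
    funext y; rw [Unique.eq_default y]; simp [flipAt]
  have h1 := hw fun _ => 1
  have h2 := hw fun _ => -1
  -- With two configurations, both sides equal ab/(a+b) times the squared increment: the Dirichlet
  -- sum counts the pair twice, which cancels its factor 1/2.
  refine ⟨(∑ τ, w τ * f τ) / ∑ τ, w τ, le_of_eq ?_⟩
  rw [show ∑ x, siteDirichlet w f x = siteDirichlet w f default from Fintype.sum_unique _,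
    siteDirichlet]
  simp only [hsum, f1, f2]
  generalize w (fun _ => 1) = a at *
  generalize w (fun _ => -1) = b at *
  have hab : a + b ≠ 0 := by positivity
  rw [add_comm b a]
  field_simp
  ring

/-! ### The Poincaré inequality on a forest -/

universe u

section Forest

variable {A : Type u} [Fintype A]

/-- The weight of a spin configuration with couplings `K` (on ordered pairs) and external
fields `h`. -/
def fieldWeight (K : A → A → ℝ) (h : A → ℤˣ → ℝ) (τ : A → ℤˣ) : ℝ :=
  Real.exp (∑ x, ∑ y, (if τ x = τ y then K x y else 0) + ∑ x, h x (τ x))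

theorem fieldWeight_pos (K : A → A → ℝ) (h : A → ℤˣ → ℝ) (τ : A → ℤˣ) : 0 < fieldWeight K h τ :=
  Real.exp_pos _

/-- No coupling crosses between the two halves, so the energy is additive. -/
theorem fieldWeight_joinConfig (p : A → Prop) [DecidablePred p] {K : A → A → ℝ}
    (hK : ∀ x y, K x y ≠ 0 → (p x ↔ p y)) (h : A → ℤˣ → ℝ) (a : {x // p x} → ℤˣ)
    (b : {x // ¬p x} → ℤˣ) :
    fieldWeight K h (joinConfig p a b) =
      fieldWeight (fun x y : {x // p x} => K x y) (fun x => h x) a *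
        fieldWeight (fun x y : {x // ¬p x} => K x y) (fun x => h x) b := by
  have hl : ∀ (x : {x // p x}) (y : {x // ¬p x}), K x y = 0 := fun x y => by
    by_contra hne; exact y.2 ((hK _ _ hne).1 x.2)
  have hr : ∀ (x : {x // ¬p x}) (y : {x // p x}), K x y = 0 := fun x y => by
    by_contra hne; exact x.2 ((hK _ _ hne).2 y.2)
  have split : ∀ φ : A → ℝ, ∑ x, φ x = ∑ x : {x // p x}, φ x + ∑ x : {x // ¬p x}, φ x :=
    fun φ => (Fintype.sum_subtype_add_sum_subtype p φ).symm
  unfold fieldWeight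
  rw [← Real.exp_add]
  congr 1
  simp only [split, joinConfig_left, joinConfig_right, hl, hr, ite_self, Finset.sum_const_zero, add_zero, zero_add]
  ring

/-- The couplings `K`, on pairs of a parent and a child, form a rooted forest with depth function
`δ`; the couplings of `x` to its children have total strength at most `a x`, and `g x` is at least
the sum of `a` along any path that descends from `x`. -/
structure IsForestBound (K : A → A → ℝ) (δ : A → ℕ) (a g : A → ℝ) : Prop where
  depth_lt : ∀ {x y}, K x y ≠ 0 → δ x < δ y
  parent_unique : ∀ {x y z}, K x z ≠ 0 → K y z ≠ 0 → x = y
  sum_abs_le : ∀ x, ∑ y, |K x y| ≤ a x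
  add_le : ∀ {x y}, K x y ≠ 0 → g y + a x ≤ g x
  le : ∀ x, a x ≤ g x

theorem IsForestBound.nonneg {K : A → A → ℝ} {δ : A → ℕ} {a g : A → ℝ}
    (H : IsForestBound K δ a g) (x : A) : 0 ≤ a x :=
  (Finset.sum_nonneg fun _ _ => abs_nonneg _).trans (H.sum_abs_le x)

theorem IsForestBound.restrict {K : A → A → ℝ} {δ : A → ℕ} {a g : A → ℝ}
    (H : IsForestBound K δ a g) (p : A → Prop) [DecidablePred p] :
    IsForestBound (fun x y : {x // p x} => K x y) (fun x => δ x) (fun x => a x) fun x => g x where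
  depth_lt h := H.depth_lt h
  parent_unique h h' := Subtype.ext (H.parent_unique h h')
  sum_abs_le x := by
    refine le_trans ?_ (H.sum_abs_le x)
    rw [← Fintype.sum_subtype_add_sum_subtype p fun y => |K x y|]
    exact le_add_of_nonneg_right (Finset.sum_nonneg fun _ _ => abs_nonneg _)
  add_le h := H.add_le h
  le x := H.le x

end Forest

/-- Deleting the couplings of `x` to its children costs a factor `exp (a x)`. -/
theorem PoincareIneq.of_delete_row {A : Type u} [Fintype A] [DecidableEq A] {K : A → A → ℝ}
    {h : A → ℤˣ → ℝ} {x : A} {t C : ℝ} (hC : 0 ≤ C) (ht : ∑ y, |K x y| ≤ t)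
    (hP : PoincareIneq (fieldWeight (fun y z => if y = x then 0 else K y z) h) C) :
    PoincareIneq (fieldWeight K h) (Real.exp t * C) := by
  have key : ∀ τ, fieldWeight K h τ = Real.exp (∑ z, if τ x = τ z then K x z else 0) *
      fieldWeight (fun y z => if y = x then 0 else K y z) h τ := fun τ => by
    unfold fieldWeight
    rw [← Real.exp_add, ← add_assoc]
    congr 2
    rw [← Finset.add_sum_erase _ _ (Finset.mem_univ x),
      ← Finset.add_sum_erase _ (fun y => ∑ z, if τ y = τ z then (if y = x then 0 else K y z) else 0)
        (Finset.mem_univ x)]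
    simp only [if_true, ite_self, Finset.sum_const_zero, zero_add]
    congr 1
    refine Finset.sum_congr rfl fun y hy => ?_
    simp only [if_neg (Finset.ne_of_mem_erase hy)]
  -- Bounding below by the negative parts and above by the positive parts makes the ratio of the
  -- bounds exp(∑|K x z|); symmetric bounds ±∑|K x z| would give its square.
  have hlow : ∀ τ : A → ℤˣ, ∑ z, min (K x z) 0 ≤ ∑ z, if τ x = τ z then K x z else 0 := fun τ =>
    Finset.sum_le_sum fun z _ => by split_ifs; exacts [min_le_left _ _, min_le_right _ _]
  have hup : ∀ τ : A → ℤˣ, ∑ z, (if τ x = τ z then K x z else 0) ≤ ∑ z, max (K x z) 0 := fun τ =>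
    Finset.sum_le_sum fun z _ => by split_ifs; exacts [le_max_left _ _, le_max_right _ _]
  have := PoincareIneq.compare (w := fieldWeight K h) (l := Real.exp (∑ z, min (K x z) 0))
    (u := Real.exp (∑ z, max (K x z) 0)) (fieldWeight_pos _ _) (Real.exp_pos _) (Real.exp_pos _).le
    hC
    (fun τ => by
      rw [key]
      exact mul_le_mul_of_nonneg_right (Real.exp_le_exp.2 (hlow τ)) (fieldWeight_pos _ _ _).le)
    (fun τ => by
      rw [key]
      exact mul_le_mul_of_nonneg_right (Real.exp_le_exp.2 (hup τ)) (fieldWeight_pos _ _ _).le) hP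
  refine this.mono (fieldWeight_pos _ _) (mul_le_mul_of_nonneg_right ?_ hC)
  rw [← Real.exp_sub, ← Finset.sum_sub_distrib]
  refine Real.exp_le_exp.2 (le_trans (le_of_eq ?_) ht)
  exact Finset.sum_congr rfl fun y _ => by rw [max_sub_min_eq_abs, zero_sub, abs_neg]

/-- Adding a root to a spin system that satisfies a Poincaré inequality. -/
theorem PoincareIneq.of_add_root {A : Type u} [Fintype A] [DecidableEq A] {K : A → A → ℝ}
    {h : A → ℤˣ → ℝ} {x : A} {t C : ℝ} (hroot : ∀ y, K y x = 0) (hC : 1 ≤ C)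
    (ht : ∑ y, |K x y| ≤ t)
    (hP : PoincareIneq (fieldWeight (fun y z : {y // y ≠ x} => K y z) fun y => h y) C) :
    PoincareIneq (fieldWeight K h) (Real.exp t * C) := by
  refine PoincareIneq.of_delete_row (x := x) (zero_le_one.trans hC) ht ?_
  have hjoin := fieldWeight_joinConfig (fun y => y ≠ x)
    (K := fun y z => if y = x then 0 else K y z) (fun y z hyz => ?_) h
  -- The isolated root is a single spin with constant 1, absorbed by `C` because `1 ≤ C`.
  · let _ : Unique {y // ¬y ≠ x} := ⟨⟨⟨x, not_not.2 rfl⟩⟩, fun y => Subtype.ext (not_not.1 y.2)⟩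
    refine PoincareIneq.prod (zero_le_one.trans hC) (fieldWeight_pos _ _) (fieldWeight_pos _ _)
      hjoin ?_ ((poincareIneq_of_unique (fieldWeight_pos _ _)).mono (fieldWeight_pos _ _) hC)
    have e : (fun y z : {y // y ≠ x} => if (y : A) = x then 0 else K y z) =
        fun y z : {y // y ≠ x} => K y z := by
      funext y z
      rw [if_neg y.2]
    rw [e]
    exact hP
  · by_cases hy : y = x
    · simp [hy] at hyz
    · rw [if_neg hy] at hyz
      exact ⟨fun _ hz => absurd (hz ▸ hroot y) hyz, fun _ => hy⟩

/-- In a nonempty forest, the vertices below a root `x` are separated from the others. -/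
theorem IsForestBound.exists_component {A : Type u} [Fintype A] [Nonempty A] {K : A → A → ℝ}
    {δ : A → ℕ} {a g : A → ℝ} (H : IsForestBound K δ a g) :
    ∃ (x : A) (D : A → Prop), D x ∧ (∀ y, K y x = 0) ∧ (∀ y z, K y z ≠ 0 → (D y ↔ D z)) ∧
      ∀ y, D y → y = x ∨ g y ≤ g x - a x := by
  -- A vertex of least depth has no parent. Its set of descendants is closed under children by
  -- construction, and under parents because parents are unique.
  obtain ⟨x, hx⟩ := Finite.exists_min δ
  have hroot : ∀ y, K y x = 0 := fun y => by
    by_contra hne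
    exact absurd (hx y) (not_le.2 (H.depth_lt hne))
  refine ⟨x, Relation.ReflTransGen (fun y z => K y z ≠ 0) x, .refl, hroot, fun y z hyz =>
    ⟨fun hy => hy.tail hyz, fun hz => ?_⟩, fun y hy => ?_⟩
  · rcases Relation.ReflTransGen.cases_tail hz with rfl | ⟨b, hb, hbz⟩
    · exact absurd (hroot y) hyz
    · rwa [H.parent_unique hyz hbz]
  · induction hy with
    | refl => exact Or.inl rfl
    | @tail b z _ hbz ihb =>
      right
      have h1 := H.add_le hbz
      rcases ihb with rfl | hb
      · linarith
      · have := H.nonneg b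
        linarith

/-- The Poincaré inequality for a spin system on a rooted forest: the constant is the exponential
of the largest sum of coupling strengths along a descending path. -/
theorem poincareIneq_of_isForestBound (n : ℕ) : ∀ (A : Type u) [Fintype A] [DecidableEq A]
    (K : A → A → ℝ) (δ : A → ℕ) (a g : A → ℝ) (h : A → ℤˣ → ℝ) (c : ℝ), Fintype.card A = n →
    IsForestBound K δ a g → (∀ x, g x ≤ c) → PoincareIneq (fieldWeight K h) (Real.exp c) := by
  classical
  induction n using Nat.strong_induction_on with
  | _ n ih =>
  intro A _ _ K δ a g h c hn H hg
  rcases isEmpty_or_nonempty A with hA | hA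
  -- There is only one configuration, so the left-hand side vanishes at its own value.
  · intro f
    refine ⟨f isEmptyElim, ?_⟩
    have : ∀ τ : A → ℤˣ, f τ = f isEmptyElim := fun τ => congrArg f (Subsingleton.elim _ _)
    simp [this]
  obtain ⟨x, D, hDx, hroot, hcross, hgD⟩ := H.exists_component
  -- The tree below `x` and the rest do not interact, so both may use the same constant exp c.
  refine PoincareIneq.prod (p := D) (Real.exp_pos _).le (fieldWeight_pos _ _) (fieldWeight_pos _ _)
    (fieldWeight_joinConfig D hcross h) ?_ ?_
  · have HD := H.restrict D
    -- Strictly below `x` every `g` is at most `g x - a x`; restoring the row of `x` multiplies by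
    -- exp(`a x`) and gives exp(`g x`).
    have hP := ih _ ?_ {y : {y // D y} // y ≠ ⟨x, hDx⟩} _ _ _ _ (fun y => h y) (g x - a x) rfl
      (HD.restrict fun y => y ≠ ⟨x, hDx⟩)
      fun y => (hgD y.1 y.1.2).resolve_left fun e => y.2 (Subtype.ext e)
    · refine (PoincareIneq.of_add_root (K := fun y z : {y // D y} => K y z) (h := fun y => h y)
        (x := ⟨x, hDx⟩) (fun y => hroot y) (Real.one_le_exp (sub_nonneg.2 (H.le x)))
        (HD.sum_abs_le ⟨x, hDx⟩) hP).mono (fieldWeight_pos _ _) ?_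
      rw [← Real.exp_add, add_sub_cancel]
      exact Real.exp_le_exp.2 (hg x)
    · rw [← hn]
      exact (Fintype.card_subtype_lt (p := fun y : {y // D y} => y ≠ ⟨x, hDx⟩) (x := ⟨x, hDx⟩)
        (not_not.2 rfl)).trans_le (Fintype.card_subtype_le _)
  · refine ih _ ?_ _ _ _ _ _ _ _ rfl (H.restrict fun y => ¬D y) fun y => hg y
    rw [← hn]
    exact Fintype.card_subtype_lt (x := x) (not_not.2 hDx)

/-! ### From the Poincaré inequality to the spectrum of Glauber dynamics -/

section HeatBath

variable {A : Type*} [DecidableEq A]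

/-- The heat-bath average of `f` at the site `x`. -/
def heatBath (w f : (A → ℤˣ) → ℝ) (x : A) (τ : A → ℤˣ) : ℝ :=
  (w τ * f τ + w (flipAt x τ) * f (flipAt x τ)) / (w τ + w (flipAt x τ))

/-- The right-hand side is antisymmetric under the flip at `x`: this is detailed balance. -/
theorem sub_heatBath {w : (A → ℤˣ) → ℝ} (hw : ∀ τ, 0 < w τ) (f : (A → ℤˣ) → ℝ) (x : A)
    (τ : A → ℤˣ) :
    w τ * (f τ - heatBath w f x τ) =
      w τ * w (flipAt x τ) / (w τ + w (flipAt x τ)) * (f τ - f (flipAt x τ)) := by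
  have h1 := hw τ
  have h2 := hw (flipAt x τ)
  unfold heatBath
  field_simp
  ring

variable [Fintype A]

/-- Pairing each configuration with its flip reduces the identities below to two-point computations.
-/
theorem sum_eq_half_sum_flipAt (x : A) (φ : (A → ℤˣ) → ℝ) :
    ∑ τ, φ τ = ∑ τ, (φ τ + φ (flipAt x τ)) / 2 := by
  rw [← Finset.sum_div, Finset.sum_add_distrib, sum_flipAt]
  ring

theorem sum_mul_sub_heatBath {w : (A → ℤˣ) → ℝ} (hw : ∀ τ, 0 < w τ) (f : (A → ℤˣ) → ℝ) (x : A) :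
    ∑ τ, w τ * (f τ - heatBath w f x τ) = 0 := by
  rw [sum_eq_half_sum_flipAt x]
  refine Finset.sum_eq_zero fun τ _ => ?_
  rw [sub_heatBath hw, sub_heatBath hw, flipAt_flipAt, add_comm (w (flipAt x τ)) (w τ)]
  ring

theorem sum_mul_self_sub_heatBath {w : (A → ℤˣ) → ℝ} (hw : ∀ τ, 0 < w τ) (f : (A → ℤˣ) → ℝ)
    (x : A) : ∑ τ, w τ * (f τ - heatBath w f x τ) * f τ = siteDirichlet w f x := by
  rw [sum_eq_half_sum_flipAt x]
  refine Finset.sum_congr rfl fun τ _ => ?_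
  rw [sub_heatBath hw, sub_heatBath hw, flipAt_flipAt, add_comm (w (flipAt x τ)) (w τ)]
  ring

/-- Heat-bath averaging is an orthogonal projection in L²(w), so its quadratic form is nonnegative;
on each flip pair it is a square. -/
theorem sum_mul_self_heatBath_nonneg {w : (A → ℤˣ) → ℝ} (hw : ∀ τ, 0 < w τ) (f : (A → ℤˣ) → ℝ)
    (x : A) : 0 ≤ ∑ τ, w τ * heatBath w f x τ * f τ := by
  rw [sum_eq_half_sum_flipAt x]
  refine Finset.sum_nonneg fun τ _ => ?_
  have h1 := hw τ
  have h2 := hw (flipAt x τ)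
  have e : (w τ * heatBath w f x τ * f τ +
      w (flipAt x τ) * heatBath w f x (flipAt x τ) * f (flipAt x τ)) / 2 =
      (w τ * f τ + w (flipAt x τ) * f (flipAt x τ)) ^ 2 / (w τ + w (flipAt x τ)) / 2 := by
    unfold heatBath
    rw [flipAt_flipAt, add_comm (w (flipAt x τ)) (w τ)]
    field_simp
    ring
  rw [e]
  positivity

theorem sum_mul_sq_pos {w f : (A → ℤˣ) → ℝ} (hw : ∀ τ, 0 < w τ) (hf : f ≠ 0) :
    0 < ∑ τ, w τ * f τ ^ 2 := by
  obtain ⟨τ, hτ⟩ := Function.ne_iff.1 hf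
  refine Finset.sum_pos' (fun τ _ => mul_nonneg (hw τ).le (sq_nonneg _))
    ⟨τ, Finset.mem_univ _, mul_pos (hw τ) (pow_pos_of_ne_zero hτ)⟩
where
  pow_pos_of_ne_zero {t : ℝ} (h : t ≠ 0) : 0 < t ^ 2 := by positivity

/-- A Poincaré inequality bounds the nonzero eigenvalues of the (negated) generator from below. -/
theorem PoincareIneq.one_le_mul_eigenvalue {w f : (A → ℤˣ) → ℝ} {C r : ℝ} (hw : ∀ τ, 0 < w τ)
    (hP : PoincareIneq w C) (hf : f ≠ 0) (hr : r ≠ 0)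
    (he : ∀ τ, ∑ x, (f τ - heatBath w f x τ) = r * f τ) : 1 ≤ C * r := by
  -- Stationarity makes an eigenfunction with nonzero eigenvalue orthogonal to constants, so any
  -- other centre only increases the second moment.
  have hmean : ∑ τ, w τ * f τ = 0 := by
    have : r * ∑ τ, w τ * f τ = 0 := by
      calc r * ∑ τ, w τ * f τ = ∑ τ, ∑ x, w τ * (f τ - heatBath w f x τ) := by
            rw [Finset.mul_sum]
            refine Finset.sum_congr rfl fun τ _ => ?_
            rw [← Finset.mul_sum, he]; ring
        _ = 0 := by
            rw [Finset.sum_comm]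
            exact Finset.sum_eq_zero fun x _ => sum_mul_sub_heatBath hw f x
    exact (mul_eq_zero.1 this).resolve_left hr
  have hdir : ∑ x, siteDirichlet w f x = r * ∑ τ, w τ * f τ ^ 2 := by
    simp only [← sum_mul_self_sub_heatBath hw]
    rw [Finset.sum_comm, Finset.mul_sum]
    refine Finset.sum_congr rfl fun τ _ => ?_
    rw [← Finset.sum_mul, ← Finset.mul_sum, he]; ring
  obtain ⟨c, hc⟩ := hP f
  rw [hdir] at hc
  have hexp : ∑ τ, w τ * (f τ - c) ^ 2 = ∑ τ, w τ * f τ ^ 2 + c ^ 2 * ∑ τ, w τ := by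
    calc _ = ∑ τ, w τ * f τ ^ 2 - 2 * c * ∑ τ, w τ * f τ + c ^ 2 * ∑ τ, w τ := by
          rw [Finset.mul_sum, Finset.mul_sum, ← Finset.sum_sub_distrib, ← Finset.sum_add_distrib]
          exact Finset.sum_congr rfl fun τ _ => by ring
      _ = _ := by rw [hmean]; ring
  have hpos := sum_mul_sq_pos hw hf
  have hZ : 0 ≤ c ^ 2 * ∑ τ, w τ :=
    mul_nonneg (sq_nonneg _) (Finset.sum_nonneg fun τ _ => (hw τ).le)
  refine le_of_mul_le_mul_right ?_ hpos
  nlinarith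

end HeatBath

/-! ### Glauber dynamics as heat-bath averaging, and its relaxation times -/

section Glauber

variable {V : Type*} [Fintype V] [DecidableEq V] (G : SimpleGraph V) (J : Sym2 V → ℝ) (β : ℝ)
  (S : Finset V) (σ : V → ℤˣ)

theorem gibbsWeight_pos (τ : S → ℤˣ) : 0 < gibbsWeight G J β S σ τ := Real.exp_pos _

theorem sum_ite_eq_off_site {A : Type*} [Fintype A] [DecidableEq A] {x : A} {τ : A → ℤˣ}
    {P : (A → ℤˣ) → Prop} [DecidablePred P] (hP : ∀ τ', P τ' ↔ ∀ y, y ≠ x → τ' y = τ y)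
    (φ : (A → ℤˣ) → ℝ) :
    ∑ τ', (if P τ' then φ τ' else 0) = φ τ + φ (flipAt x τ) := by
  rw [← Finset.sum_filter]
  have h : ∑ s : ℤˣ, φ (Function.update τ x s) = φ τ + φ (flipAt x τ) := by
    rw [sum_units_eq _ (τ x), Function.update_eq_self, flipAt]
  have hup : ∀ τ', P τ' → Function.update τ x (τ' x) = τ' := fun τ' h => by
    funext y
    by_cases hy : y = x
    · subst hy; simp
    · rw [Function.update_of_ne hy]; exact ((hP τ').1 h y hy).symm
  rw [← h]
  refine Finset.sum_nbij' (fun τ' => τ' x) (fun s => Function.update τ x s) ?_ ?_ ?_ ?_ ?_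
  · exact fun _ _ => Finset.mem_univ _
  · intro s _
    simp only [Finset.mem_filter, Finset.mem_univ, true_and, hP]
    exact fun y hy => Function.update_of_ne hy _ _
  · exact fun τ' h => hup τ' (Finset.mem_filter.1 h).2
  · simp
  · exact fun τ' h => by rw [hup τ' (Finset.mem_filter.1 h).2]

theorem siteUpdate_mulVec (x : S) (f : (S → ℤˣ) → ℝ) (τ : S → ℤˣ) :
    (siteUpdate G J β S σ x).mulVec f τ = heatBath (gibbsWeight G J β S σ) f x τ := by
  classical
  have hZ : 0 < ∑ τ', gibbsWeight G J β S σ τ' :=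
    Finset.sum_pos (fun τ' _ => gibbsWeight_pos G J β S σ τ') Finset.univ_nonempty
  have h1 := gibbsWeight_pos G J β S σ τ
  have h2 := gibbsWeight_pos G J β S σ (flipAt x τ)
  have hden : ∑ s : ℤˣ, gibbs G J β S σ (Function.update τ x s) =
      gibbs G J β S σ τ + gibbs G J β S σ (flipAt x τ) := by
    rw [sum_units_eq _ (τ x), Function.update_eq_self, flipAt]
  simp only [Matrix.mulVec, dotProduct, siteUpdate, ite_mul, zero_mul, hden]
  rw [sum_ite_eq_off_site (fun _ => Iff.rfl) fun τ' =>
    gibbs G J β S σ τ' / (gibbs G J β S σ τ + gibbs G J β S σ (flipAt x τ)) * f τ']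
  unfold gibbs heatBath
  field_simp

theorem sum_sub_heatBath_eq (f : (S → ℤˣ) → ℝ) (τ : S → ℤˣ) :
    ∑ x, (f τ - heatBath (gibbsWeight G J β S σ) f x τ) =
      (-glauberGenerator G J β S σ).mulVec f τ := by
  simp only [glauberGenerator, Matrix.neg_mulVec, Matrix.sum_mulVec, Matrix.sub_mulVec,
    Matrix.one_mulVec, Pi.neg_apply, Finset.sum_apply, Pi.sub_apply, siteUpdate_mulVec]
  rw [← Finset.sum_neg_distrib]
  exact Finset.sum_congr rfl fun x _ => by ring

theorem sum_heatBath_eq (f : (S → ℤˣ) → ℝ) (τ : S → ℤˣ) (hS : S.Nonempty) :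
    ∑ x, heatBath (gibbsWeight G J β S σ) f x τ =
      S.card * (glauberMatrix G J β S σ).mulVec f τ := by
  have hc : (S.card : ℝ) ≠ 0 := by exact_mod_cast hS.card_ne_zero
  simp only [glauberMatrix, Matrix.smul_mulVec, Matrix.sum_mulVec, Pi.smul_apply,
    Finset.sum_apply, siteUpdate_mulVec, smul_eq_mul]
  rw [← mul_assoc, mul_inv_cancel₀ hc, one_mul]

variable {G J β S σ}

theorem relaxationTime_le_of_poincareIneq {C : ℝ} (hC : 0 < C)
    (hP : PoincareIneq (gibbsWeight G J β S σ) C) :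
    relaxationTime (glauberGenerator G J β S σ) ≤ C := by
  unfold relaxationTime
  set R := {r | Module.End.HasEigenvalue (Matrix.toLin' (-glauberGenerator G J β S σ)) r ∧ r ≠ 0}
  have hR : ∀ r ∈ R, 1 / C ≤ r := by
    rintro r ⟨hr, hr0⟩
    obtain ⟨f, hf⟩ := hr.exists_hasEigenvector
    have he : ∀ τ, ∑ x, (f τ - heatBath (gibbsWeight G J β S σ) f x τ) = r * f τ := fun τ => by
      rw [sum_sub_heatBath_eq, ← Matrix.toLin'_apply, hf.apply_eq_smul]
      rfl
    have := hP.one_le_mul_eigenvalue (gibbsWeight_pos G J β S σ) hf.2 hr0 he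
    rwa [div_le_iff₀ hC, mul_comm]
  rcases R.eq_empty_or_nonempty with h | h
  -- Without nonzero eigenvalues, the defaults sInf ∅ = 0 and 1/0 = 0 make the bound trivial.
  · rw [h, Real.sInf_empty, div_zero]
    exact hC.le
  · rw [one_div_le ((one_div_pos.2 hC).trans_le (le_csInf h hR)) hC]
    exact le_csInf h hR

theorem discreteRelaxationTime_le_of_poincareIneq {C : ℝ} (hC : 1 ≤ C) (hS : S.Nonempty)
    (hP : PoincareIneq (gibbsWeight G J β S σ) C) :
    discreteRelaxationTime (glauberMatrix G J β S σ) ≤ S.card * C := by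
  have hw := gibbsWeight_pos G J β S σ
  have hc : (1 : ℝ) ≤ S.card := by exact_mod_cast hS.card_pos
  have hSC : 1 ≤ S.card * C := one_le_mul_of_one_le_of_one_le hc hC
  have hSC0 : 0 < S.card * C := by linarith
  unfold discreteRelaxationTime
  set R := {r | ∃ l : ℝ, Module.End.HasEigenvalue (Matrix.toLin' (glauberMatrix G J β S σ)) l ∧
    l ≠ 1 ∧ r = |l|}
  have hR : sSup R ≤ 1 - 1 / (S.card * C) := by
    -- The bound must be nonnegative to cover the default sSup ∅ = 0; this uses `1 ≤ C`.
    refine Real.sSup_le ?_ (sub_nonneg.2 ((div_le_one hSC0).2 hSC))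
    rintro _ ⟨l, hl, hl1, rfl⟩
    obtain ⟨f, hf⟩ := hl.exists_hasEigenvector
    have hsum : ∀ τ, ∑ x, heatBath (gibbsWeight G J β S σ) f x τ = S.card * (l * f τ) := fun τ => by
      rw [sum_heatBath_eq _ _ _ _ _ _ _ hS, ← Matrix.toLin'_apply, hf.apply_eq_smul]
      rfl
    -- An eigenvalue l of the discrete chain is the eigenvalue |S|(1 - l) of the negated generator.
    have he : ∀ τ, ∑ x, (f τ - heatBath (gibbsWeight G J β S σ) f x τ) =
        S.card * (1 - l) * f τ := fun τ => by
      rw [Finset.sum_sub_distrib, hsum, Finset.sum_const, Finset.card_univ, Fintype.card_coe,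
        nsmul_eq_mul]
      ring
    have hgap := hP.one_le_mul_eigenvalue hw hf.2
      (mul_ne_zero (by linarith) (sub_ne_zero.2 hl1.symm)) he
    have hl0 : 0 ≤ l := by
      have h1 : 0 ≤ ∑ x : S, ∑ τ, gibbsWeight G J β S σ τ *
          heatBath (gibbsWeight G J β S σ) f x τ * f τ :=
        Finset.sum_nonneg fun x _ => sum_mul_self_heatBath_nonneg hw f x
      have h2 : ∑ x : S, ∑ τ, gibbsWeight G J β S σ τ *
          heatBath (gibbsWeight G J β S σ) f x τ * f τ =
          S.card * l * ∑ τ, gibbsWeight G J β S σ τ * f τ ^ 2 := by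
        rw [Finset.sum_comm, Finset.mul_sum]
        refine Finset.sum_congr rfl fun τ _ => ?_
        rw [← Finset.sum_mul, ← Finset.mul_sum, hsum]
        ring
      rw [h2] at h1
      have h3 := nonneg_of_mul_nonneg_left h1 (sum_mul_sq_pos hw hf.2)
      exact nonneg_of_mul_nonneg_right h3 (by linarith)
    rw [abs_of_nonneg hl0]
    have : 1 / (S.card * C) ≤ 1 - l := by
      rw [div_le_iff₀ hSC0]
      linarith
    linarith
  have hgap : 1 / (S.card * C) ≤ 1 - sSup R := by linarith
  rw [one_div_le ((one_div_pos.2 hSC0).trans_le hgap) hSC0]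
  exact hgap

end Glauber

/-! ### Paths in the trees -/

section Tree

variable {V : Type*} {G : SimpleGraph V} {S : Finset V} {v : V}

/-- The paths from the root of an induced tree: along an edge, one of the two paths extends
the other. -/
theorem exists_root_paths (hT : (G.induce (S : Set V)).IsTree) (hv : v ∈ S) :
    ∃ P : V → List V,
      (∀ x ∈ S, ∃ p : G.Walk v x, p.IsPath ∧ p.support = P x ∧ ∀ y ∈ P x, y ∈ S) ∧
      ∀ x ∈ S, ∀ y ∈ S, G.Adj x y → P y = P x ++ [y] ∨ P x = P y ++ [x] := by
  classical
  choose q hq _ using hT.existsUnique_path ⟨v, Finset.mem_coe.2 hv⟩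
  refine ⟨fun x => if hx : x ∈ S then (q ⟨x, Finset.mem_coe.2 hx⟩).support.map Subtype.val else [],
    fun x hx => ?_, fun x hx y hy hxy => ?_⟩
  · simp only [dif_pos hx]
    refine ⟨(q ⟨x, Finset.mem_coe.2 hx⟩).map (SimpleGraph.Embedding.induce _).toHom,
      (hq _).map Subtype.val_injective, SimpleGraph.Walk.support_map _ _, fun y hy => ?_⟩
    obtain ⟨z, _, rfl⟩ := List.mem_map.1 hy
    exact Finset.mem_coe.1 z.2
  · simp only [dif_pos hx, dif_pos hy]
    set x' : (S : Set V) := ⟨x, Finset.mem_coe.2 hx⟩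
    set y' : (S : Set V) := ⟨y, Finset.mem_coe.2 hy⟩
    have hadj : (G.induce (S : Set V)).Adj x' y' := hxy
    by_cases h : x' ∈ (q y').support
    · left
      rw [hT.isAcyclic.path_concat (hq x') (hq y') hadj h, SimpleGraph.Walk.support_concat]
      simp [y']
    · right
      have h' := hT.isAcyclic.mem_support_of_ne_mem_support_of_adj_of_isPath (hq x') (hq y') hadj h
      rw [hT.isAcyclic.path_concat (hq y') (hq x') hadj.symm h', SimpleGraph.Walk.support_concat]
      simp [x']

/-- Every path from the root in `S` extends to a path from the root to a leaf. -/
theorem exists_rootToLeafPath [Fintype V] {x : V} (p : G.Walk v x) (hp : p.IsPath)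
    (hS : ∀ y ∈ p.support, y ∈ S) :
    ∃ (u : V) (q : G.Walk v u), IsRootToLeafPath G S q ∧ ∀ y ∈ p.support, y ∈ q.support := by
  -- Greedy extension: while the endpoint is not a leaf, append a neighbour in `S` off the path.
  -- Paths have fewer than |V| edges, so this stops.
  induction hn : Fintype.card V - p.length using Nat.strong_induction_on generalizing x p with
  | _ n ih =>
  by_cases hleaf : ∀ w ∈ S, G.Adj x w → w ∈ p.support
  · exact ⟨x, p, ⟨hp, hS, hleaf⟩, fun _ h => h⟩
  · push Not at hleaf
    obtain ⟨w, hwS, hxw, hw⟩ := hleaf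
    have hlt := hp.length_lt
    obtain ⟨u, q, hq, hsub⟩ := ih _ (by rw [SimpleGraph.Walk.length_concat]; omega)
      (p.concat hxw) (hp.concat hw hxw) (fun y hy => by
        rw [SimpleGraph.Walk.support_concat, List.mem_append, List.mem_singleton] at hy
        rcases hy with hy | rfl
        exacts [hS y hy, hwS]) rfl
    exact ⟨u, q, hq, fun y hy => hsub y (p.support_subset_support_concat hxw hy)⟩

theorem finite_rootToLeafWeights [Fintype V] [DecidableEq V] (J : Sym2 V → ℝ) (β : ℝ) :
    (rootToLeafWeights G J β S v).Finite := by
  classical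
  refine (Set.finite_range fun q : (u : V) × G.Path v u => pathUpsilon G J β q.2.1).subset ?_
  rintro a ⟨u, p, hp, rfl⟩
  exact ⟨⟨u, p, hp.1⟩, rfl⟩

theorem exists_isGreatest_rootToLeafWeights [Fintype V] [DecidableEq V] (J : Sym2 V → ℝ) (β : ℝ)
    (hv : v ∈ S) : ∃ m, IsGreatest (rootToLeafWeights G J β S v) m := by
  obtain ⟨u, q, hq, -⟩ := exists_rootToLeafPath (S := S) (SimpleGraph.Walk.nil : G.Walk v v)
    SimpleGraph.Walk.IsPath.nil (by simpa using hv)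
  exact (finite_rootToLeafWeights J β).isCompact.exists_isGreatest ⟨_, u, q, hq, rfl⟩

end Tree

/-! ### Edge sums, and the Gibbs weight on a tree as a forest system -/

section Edges

variable {V : Type*} [Fintype V] [DecidableEq V] {G : SimpleGraph V} {S : Finset V}

open Classical in
/-- The sum over the edges that meet `S`, when the edges inside `S` are oriented by `child`. -/
theorem sum_edges_meeting {child : V → V → Prop} (hadj : ∀ {x y}, child x y → G.Adj x y)
    (htot : ∀ x ∈ S, ∀ y ∈ S, G.Adj x y → child x y ∨ child y x)
    (hasymm : ∀ {x y}, child x y → ¬child y x) (φ : Sym2 V → ℝ) :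
    ∑ e ∈ G.edgeFinset.filter (fun e => ∃ x ∈ S, x ∈ e), φ e =
      ∑ x ∈ S, ∑ y ∈ S, (if child x y then φ s(x, y) else 0) +
        ∑ x ∈ S, ∑ y ∈ Sᶜ, (if G.Adj x y then φ s(x, y) else 0) := by
  have h : ∑ q ∈ (S ×ˢ Finset.univ).filter
      (fun q : V × V => (q.2 ∈ S ∧ child q.1 q.2) ∨ (q.2 ∉ S ∧ G.Adj q.1 q.2)), φ s(q.1, q.2) =
      ∑ x ∈ S, ∑ y ∈ S, (if child x y then φ s(x, y) else 0) +
        ∑ x ∈ S, ∑ y ∈ Sᶜ, (if G.Adj x y then φ s(x, y) else 0) := by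
    rw [Finset.sum_filter, Finset.sum_product, ← Finset.sum_add_distrib]
    refine Finset.sum_congr rfl fun x _ => ?_
    rw [← Finset.sum_add_sum_compl S]
    congr 1
    · exact Finset.sum_congr rfl fun y hy => by simp [hy]
    · exact Finset.sum_congr rfl fun y hy => by simp [Finset.mem_compl.1 hy]
  rw [← h]
  symm
  -- Each edge meeting `S` has one representative: the pair (parent, child) if it lies inside `S`,
  -- the pair with its endpoint in `S` first otherwise.
  refine Finset.sum_bij (fun q _ => s(q.1, q.2)) ?_ ?_ ?_ fun _ _ => rfl
  · rintro ⟨x, y⟩ hq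
    simp only [Finset.mem_filter, Finset.mem_product, Finset.mem_univ, and_true] at hq
    simp only [Finset.mem_filter, SimpleGraph.mem_edgeFinset, SimpleGraph.mem_edgeSet]
    refine ⟨?_, x, hq.1, Sym2.mem_mk_left _ _⟩
    rcases hq.2 with h | h
    exacts [hadj h.2, h.2]
  · rintro ⟨x, y⟩ hq ⟨x', y'⟩ hq' he
    simp only [Finset.mem_filter, Finset.mem_product, Finset.mem_univ, and_true] at hq hq'
    rcases Sym2.eq_iff.1 he with ⟨h1, h2⟩ | ⟨h1, h2⟩
    · simp only at h1 h2
      rw [h1, h2]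
    · simp only at h1 h2
      subst h1 h2
      rcases hq.2 with h | h
      · rcases hq'.2 with h' | h'
        exacts [absurd h'.2 (hasymm h.2), absurd hq.1 h'.1]
      · exact absurd hq'.1 h.1
  · intro e he
    induction e using Sym2.ind with
    | _ x y =>
    simp only [Finset.mem_filter, SimpleGraph.mem_edgeFinset, SimpleGraph.mem_edgeSet] at he
    obtain ⟨hxy, z, hz, hze⟩ := he
    have main : ∀ x y, x ∈ S → G.Adj x y → ∃ q : V × V, ∃ _ : q ∈ (S ×ˢ Finset.univ).filter
        (fun q : V × V => (q.2 ∈ S ∧ child q.1 q.2) ∨ (q.2 ∉ S ∧ G.Adj q.1 q.2)),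
        s(q.1, q.2) = s(x, y) := fun x y hx hxy => by
      by_cases hy : y ∈ S
      · rcases htot x hx y hy hxy with h | h
        · exact ⟨(x, y), by simp [hx, hy, h], rfl⟩
        · exact ⟨(y, x), by simp [hx, hy, h], Sym2.eq_swap⟩
      · exact ⟨(x, y), by simp [hx, hy, hxy], rfl⟩
    rcases Sym2.mem_iff.1 hze with rfl | rfl
    · exact main _ _ hz hxy
    · rw [Sym2.eq_swap]
      exact main _ _ hz hxy.symm

open Classical in
/-- The Gibbs weight in terms of oriented couplings and boundary fields. -/
theorem gibbsWeight_eq_fieldWeight (J : Sym2 V → ℝ) (β : ℝ) (σ : V → ℤˣ) {child : V → V → Prop}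
    (hadj : ∀ {x y}, child x y → G.Adj x y)
    (htot : ∀ x ∈ S, ∀ y ∈ S, G.Adj x y → child x y ∨ child y x)
    (hasymm : ∀ {x y}, child x y → ¬child y x) :
    gibbsWeight G J β S σ =
      fieldWeight (fun x y : S => if child x y then β * J s(x.1, y.1) else 0)
        fun x s => ∑ y ∈ Sᶜ, if G.Adj x y then (if s = σ y then β * J s(x.1, y) else 0) else 0 := by
  funext τ
  unfold gibbsWeight fieldWeight
  congr 1
  rw [sum_edges_meeting hadj htot hasymm, mul_add, Finset.mul_sum, Finset.mul_sum,
    ← Finset.sum_coe_sort S, ← Finset.sum_coe_sort S]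
  congr 1
  · refine Finset.sum_congr rfl fun x _ => ?_
    rw [Finset.mul_sum, ← Finset.sum_coe_sort S]
    refine Finset.sum_congr rfl fun y _ => ?_
    have hx : glue σ τ x.1 = τ x := by simp [glue]
    have hy : glue σ τ y.1 = τ y := by simp [glue]
    by_cases hc : child x y <;> by_cases ht : τ x = τ y <;> simp [hc, hx, hy, ht, eq_comm]
  · refine Finset.sum_congr rfl fun x _ => ?_
    rw [Finset.mul_sum]
    refine Finset.sum_congr rfl fun y hy => ?_
    have hx : glue σ τ x.1 = τ x := by simp [glue]
    have hy' : glue σ τ y = σ y := by simp [glue, Finset.mem_compl.1 hy]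
    by_cases hc : G.Adj x y <;> by_cases ht : τ x = σ y <;> simp [hc, hx, hy', ht, eq_comm]

open Classical in
/-- The couplings from the vertices of a path to their children are part of the weight of
the path. -/
theorem sum_child_le_pathUpsilon (J : Sym2 V → ℝ) {β : ℝ} (hβ : 0 ≤ β) {child : V → V → Prop}
    (hadj : ∀ {x y}, child x y → G.Adj x y) (hasymm : ∀ {x y}, child x y → ¬child y x)
    {u w : V} (p : G.Walk u w) {R : Finset V} (hR : ∀ y ∈ R, y ∈ p.support) :
    ∑ x ∈ R, ∑ y ∈ S, |if child x y then β * J s(x, y) else 0| ≤ pathUpsilon G J β p := by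
  have hdeg : 0 ≤ ∑ x ∈ p.support.toFinset, Real.log (G.degree x) :=
    Finset.sum_nonneg fun x _ => Real.log_natCast_nonneg _
  refine le_trans ?_ (le_add_of_nonneg_right hdeg)
  set Q := (R ×ˢ S).filter fun q : V × V => child q.1 q.2 with hQ
  have h : ∑ x ∈ R, ∑ y ∈ S, |if child x y then β * J s(x, y) else 0| =
      β * ∑ q ∈ Q, |J s(q.1, q.2)| := by
    rw [hQ, Finset.sum_filter, Finset.sum_product, Finset.mul_sum]
    refine Finset.sum_congr rfl fun x _ => ?_
    rw [Finset.mul_sum]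
    refine Finset.sum_congr rfl fun y _ => ?_
    by_cases hc : child x y <;> simp [hc, abs_mul, abs_of_nonneg hβ]
  rw [h]
  refine mul_le_mul_of_nonneg_left ?_ hβ
  -- No edge is counted in both directions, by asymmetry of `child`.
  have hinj : Set.InjOn (fun q : V × V => s(q.1, q.2)) Q := by
    rintro ⟨x, y⟩ hq ⟨x', y'⟩ hq' he
    have h1 := (Finset.mem_filter.1 hq).2
    have h2 := (Finset.mem_filter.1 hq').2
    rcases Sym2.eq_iff.1 he with ⟨e1, e2⟩ | ⟨e1, e2⟩
    · simp only at e1 e2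
      rw [e1, e2]
    · simp only at e1 e2 h1 h2
      subst e1 e2
      exact absurd h2 (hasymm h1)
  rw [← Finset.sum_image (f := fun e => |J e|) hinj]
  refine Finset.sum_le_sum_of_subset_of_nonneg ?_ fun _ _ _ => abs_nonneg _
  intro e he
  obtain ⟨⟨x, y⟩, hq, rfl⟩ := Finset.mem_image.1 he
  have hq' := Finset.mem_filter.1 hq
  simp only [Finset.mem_filter, SimpleGraph.mem_edgeFinset, SimpleGraph.mem_edgeSet]
  exact ⟨hadj hq'.2, x, hR x (Finset.mem_product.1 hq'.1).1, Sym2.mem_mk_left _ _⟩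

/-- The Poincaré inequality for the Gibbs distribution on an induced tree. -/
theorem poincareIneq_gibbsWeight (J : Sym2 V → ℝ) {β : ℝ} (hβ : 0 ≤ β) {v : V}
    (hT : (G.induce (S : Set V)).IsTree) (hv : v ∈ S) (σ : V → ℤˣ) {m : ℝ}
    (hm : m ∈ upperBounds (rootToLeafWeights G J β S v)) :
    PoincareIneq (gibbsWeight G J β S σ) (Real.exp m) := by
  classical
  obtain ⟨P, hP, hext⟩ := exists_root_paths hT hv
  obtain ⟨child, hchild⟩ : ∃ child : V → V → Prop, ∀ x y, child x y ↔
      G.Adj x y ∧ P y = P x ++ [y] := ⟨_, fun _ _ => Iff.rfl⟩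
  have hadj : ∀ {x y}, child x y → G.Adj x y := fun h => ((hchild _ _).1 h).1
  have happ : ∀ {x y}, child x y → P y = P x ++ [y] := fun h => ((hchild _ _).1 h).2
  have hlen : ∀ {x y}, child x y → (P x).length < (P y).length := fun h => by
    rw [happ h, List.length_append, List.length_singleton]
    exact Nat.lt_succ_self _
  have hasymm : ∀ {x y}, child x y → ¬child y x := fun h h' => (hlen h).asymm (hlen h')
  have htot : ∀ x ∈ S, ∀ y ∈ S, G.Adj x y → child x y ∨ child y x := fun x hx y hy h =>
    (hext x hx y hy h).imp (fun e => (hchild _ _).2 ⟨h, e⟩) fun e => (hchild _ _).2 ⟨h.symm, e⟩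
  rw [gibbsWeight_eq_fieldWeight J β σ hadj htot hasymm]
  set a : V → ℝ := fun x => ∑ y ∈ S, |if child x y then β * J s(x, y) else 0| with ha
  have ha0 : ∀ x, 0 ≤ a x := fun x => Finset.sum_nonneg fun _ _ => abs_nonneg _
  -- The path to `x` extends to a leaf, so its accumulated cost is within the budget `m`.
  have hB : ∀ x ∈ S, ((P x).map a).sum ≤ m := fun x hx => by
    obtain ⟨p, hp, hsupp, hpS⟩ := hP x hx
    obtain ⟨u, q, hq, hsub⟩ := exists_rootToLeafPath p hp (fun y hy => hpS y (hsupp ▸ hy))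
    rw [← hsupp, ← List.sum_toFinset a hp.support_nodup]
    exact (sum_child_le_pathUpsilon J hβ hadj hasymm q
      fun y hy => hsub y (List.mem_toFinset.1 hy)).trans (hm ⟨u, q, hq, rfl⟩)
  have hstep : ∀ {x y}, child x y → ((P y).map a).sum = ((P x).map a).sum + a y := fun h => by
    rw [happ h, List.map_append, List.sum_append]
    simp
  have hne : ∀ {x y}, (if child x y then β * J s(x, y) else 0) ≠ 0 → child x y := fun h => by
    by_contra hc
    exact h (if_neg hc)
  -- The choice of `g` is the part of the budget `m` not spent strictly above `x`; `add_le` then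
  -- holds with equality.
  refine poincareIneq_of_isForestBound _ S _ (fun x => (P x).length) (fun x => a x)
    (fun x => m - ((P x).map a).sum + a x) _ m rfl ⟨fun h => hlen (hne h), ?_, fun x => ?_, ?_, ?_⟩ ?_
  -- The path to `z` without its last vertex is the path to the parent, and the end of that path is
  -- the parent itself.
  · intro x y z hx hy
    have e : P x = P y := List.append_cancel_right ((happ (hne hx)).symm.trans (happ (hne hy)))
    obtain ⟨p, -, hp, -⟩ := hP x x.2
    obtain ⟨q, -, hq, -⟩ := hP y y.2
    have h := p.getLast_support
    have h' := q.getLast_support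
    simp only [hp, e] at h
    simp only [hq] at h'
    exact Subtype.ext (h.symm.trans h')
  · exact (Finset.sum_coe_sort S fun y => |if child x y then β * J s(x.1, y) else 0|).le
  · intro x y h
    have := hstep (hne h)
    linarith
  · intro x
    have := hB x x.2
    linarith
  · intro x
    obtain ⟨p, -, hp, -⟩ := hP x x.2
    have hmem : a x ∈ (P x).map a := List.mem_map_of_mem (hp ▸ p.end_mem_support)
    have : a x ≤ ((P x).map a).sum := List.single_le_sum (fun b hb => by
      obtain ⟨y, -, rfl⟩ := List.mem_map.1 hb
      exact ha0 y) _ hmem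
    linarith

end Edges

end SpinGlass

end

theorem mainTheorem6 {V : Type*} [Fintype V] [DecidableEq V] (G : SimpleGraph V)
    (J : Sym2 V → ℝ) (β d ε : ℝ) (hβ : 0 < β) (hd : 0 < d) (hε : 0 < ε)
    (𝓑 : Finpartition (Finset.univ : Finset V))
    (h𝓑 : SpinGlass.IsBlockPartition G J β d ε 𝓑)
    (S : Finset V) (v : V) (hT : SpinGlass.IsBlockTree G 𝓑 S v) (σ : V → ℤˣ) :
    ∃ m : ℝ, IsGreatest (SpinGlass.rootToLeafWeights G J β S v) m ∧
      SpinGlass.relaxationTime (SpinGlass.glauberGenerator G J β S σ) ≤ Real.exp m ∧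
      SpinGlass.discreteRelaxationTime (SpinGlass.glauberMatrix G J β S σ) ≤
        S.card * Real.exp m := by
  obtain ⟨htree, B, -, hB⟩ := hT
  have hv : v ∈ S := by
    rcases hB with ⟨-, -, -, hv⟩ | ⟨c, -, -, rfl⟩
    · exact hv
    · simp
  obtain ⟨m, hm⟩ := SpinGlass.exists_isGreatest_rootToLeafWeights J β hv
  have hP := SpinGlass.poincareIneq_gibbsWeight J hβ.le htree hv σ hm.2
  -- Nonnegativity of `m` gives 1 ≤ exp m, which the discrete-time bound needs.
  have hm0 : 0 ≤ m := by
    obtain ⟨u, p, -, rfl⟩ := hm.1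
    exact add_nonneg (mul_nonneg hβ.le (Finset.sum_nonneg fun _ _ => abs_nonneg _))
      (Finset.sum_nonneg fun _ _ => Real.log_natCast_nonneg _)
  exact ⟨m, hm, SpinGlass.relaxationTime_le_of_poincareIneq (Real.exp_pos m) hP,
    SpinGlass.discreteRelaxationTime_le_of_poincareIneq (Real.one_le_exp hm0) ⟨v, hv⟩ hP⟩
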